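/- Let $T\subset\mathbb R^2$ be any (closed, filled, non-degenerate) equilateral triangle with vertices $p_0,p_1,p_2$. Let $S=\bigcap_{n\ge 0}S_n$ be the Sierpinski gasket constructed in $T$, where $S_0=T$ and $S_{n+1}=\bigcup_{i=0}^{2}\{\tfrac12(p_i+x):x\in S_n\}$. Equip $S$ with the Euclidean distance $d$ and with the $\alpha$-dimensional Hausdorff measure $\mathscr H^\alpha$, where $\alpha=\frac{\log 3}{\log 2}$. Let $F=\partial T$ be the boundary of the triangle, and let $\nu$ be the length ($\mathscr H^1$) restricted to $F$. A set $Y$ in a metric space is called $s$-Ahlfors with a Borel measure $\mu$ supported in $Y$ if there is $c\ge 1$ with $c^{-1}r^s\le\mu(B(x,r))\le c\,r^s$ for all $x\in Y$ and $0<r<\operatorname{diam}(Y)$, where $B(x,r)$ is the open ball. A measurable function $w:S\to[0,\infty]$ belongs to $A_1(S,d,\mathscr H^\alpha)$ if every ball $B$ of $S$ satisfies $0<\mathscr H^\alpha(B)<\infty$ and $\int_B w\,d\mathscr H^\alpha<\infty$, and there is a constant $C$ such that $$\frac1{\mathscr H^\alpha(B)}\int_B w\,d\mathscr H^\alpha\le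 C\,w(x)$$ for every ball $B$ of $S$ and $\mathscr H^\alpha$-almost every $x\in B$. Then $S$ is $\alpha$-Ahlfors with $\mathscr H^\alpha$, the set $F$ is contained in $S$ and is $1$-Ahlfors with $\nu$, and $$d(x,F)^{(1-\alpha)\gamma}\in A_1(S,d,\mathscr H^\alpha)\qquad\text{for every }0\le\gamma<1,$$ where $d(x,F)=\inf\{d(x,y):y\in F\}$ and, for $\gamma>0$, the weight has the value $\infty$ on $F$. -/

import Mathlib

open MeasureTheory Metric Set
open scoped ENNReal NNReal

/-- The Euclidean plane. -/
abbrev Plane : Type := EuclideanSpace ℝ (Fin 2)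

/-- A subset `Y` of a metric space `X` is `s`-Ahlfors with measure `μ`: the Borel measure `μ` is
supported in `Y`, and for some `c ≥ 1` one has `c⁻¹ r ^ s ≤ μ (B(x, r)) ≤ c r ^ s` for all `x ∈ Y`
and all `0 < r < diam Y`. The diameter is extended-valued, so unbounded `Y` are allowed. -/
def IsAhlfors {X : Type*} [MetricSpace X] [MeasurableSpace X]
    (Y : Set X) (s : ℝ) (μ : Measure X) : Prop :=
  μ Yᶜ = 0 ∧
  ∃ c : ℝ, 1 ≤ c ∧ ∀ x ∈ Y, ∀ r : ℝ, 0 < r → ENNReal.ofReal r < ediam Y →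
    ENNReal.ofReal (c⁻¹ * r ^ s) ≤ μ (ball x r) ∧ μ (ball x r) ≤ ENNReal.ofReal (c * r ^ s)

/-- The Muckenhoupt class `A₁(X, d, μ)`. Weights take values in `[0, ∞]`, so that a negative
power of a distance has the value `∞` where the distance vanishes. -/
structure IsMuckenhouptA1 {X : Type*} [MetricSpace X] [MeasurableSpace X]
    (μ : Measure X) (w : X → ℝ≥0∞) : Prop where
  /-- every ball has positive measure -/
  ball_pos : ∀ (x : X) (r : ℝ), 0 < r → 0 < μ (ball x r)
  /-- every ball has finite measure -/
  ball_lt_top : ∀ (x : X) (r : ℝ), 0 < r → μ (ball x r) < ∞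
  /-- the weight is measurable -/
  aemeasurable : AEMeasurable w μ
  /-- the weight is integrable over balls -/
  integrable_ball : ∀ (x : X) (r : ℝ), 0 < r → ∫⁻ y in ball x r, w y ∂μ < ∞
  /-- the average over a ball is at most a constant times almost every value in that ball -/
  average_le : ∃ C : ℝ≥0, ∀ (z : X) (r : ℝ), 0 < r →
    ∀ᵐ x ∂μ, x ∈ ball z r → (∫⁻ y in ball z r, w y ∂μ) / μ (ball z r) ≤ C * w x

/-- The full (closed, filled) triangle with vertices `T.points i`. -/
def fullTriangle (T : Affine.Triangle ℝ Plane) : Set Plane :=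
  convexHull ℝ (range T.points)

/-- The `n`-th step of the construction of the Sierpinski gasket in `T`: start with the full
triangle, and in each step take the three half-size copies with centres at the vertices (that is,
remove the open middle triangle of each remaining triangle). -/
def gasketStep (T : Affine.Triangle ℝ Plane) : ℕ → Set Plane
  | 0 => fullTriangle T
  | n + 1 => ⋃ i : Fin 3, (fun x => midpoint ℝ (T.points i) x) '' gasketStep T n

/-- The Sierpinski gasket constructed in `T`. -/
def sierpinskiGasket (T : Affine.Triangle ℝ Plane) : Set Plane :=
  ⋂ n : ℕ, gasketStep T n

/-- The boundary of the triangle. -/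
def triangleBoundary (T : Affine.Triangle ℝ Plane) : Set Plane :=
  frontier (fullTriangle T)

/-!
The argument runs in barycentric coordinates and compares every measure with the uniform measure
on addresses, that is, on the sequences `ω : ℕ → Fin 3` of independent uniformly distributed
symbols.

The triangle of level `n` with address `ω 0, …, ω (n - 1)` (`cell`) is the set of points whose
coordinates, multiplied by `2ⁿ`, exceed those of an integer vector (`corner`) by at most `1`. Any
two coordinates of the corner determine the first `n` symbols, so that counting triangles reduces to
counting integers in intervals (`addressMeasure_corner_mem_le`): at most a constant number of
triangles of level `n` meet a ball of radius comparable to `2⁻ⁿ`, and at most a multiple of `2ᵏ`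
triangles of level `m + k` meet a ball of radius comparable to `2⁻ᵐ` and lie near the boundary,
where one of the coordinates is bounded (`addressMeasure_meets_layer_le`).

With `2 ^ α = 3`, a triangle of level `n` has diameter to the power `α` comparable to `3⁻ⁿ`, which
is the measure of its addresses. Covering by triangles therefore bounds the Hausdorff measure from
above (`hausdorffMeasure_le_addressMeasure`), and the mass distribution principle bounds it from
below (`exists_map_addressMeasure_le`). This gives the Ahlfors regularity of the gasket, and the
bound `2ᵏ 3⁻⁽ᵐ⁺ᵏ⁾`, up to a constant, for the part of a ball of radius comparable to `2⁻ᵐ` that is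
closer to the boundary than a multiple of `2⁻⁽ᵐ⁺ᵏ⁾`.

For the weight `d ^ (-s)`, where `s = (α - 1) γ`, the layer bound and a geometric series of ratio
`2 ^ (1 + s) / 3 < 2 ^ α / 3 = 1` show that the integral over such a ball is at most a multiple of
`3⁻ᵐ 2 ^ (m s)`. This is the `A₁` condition for balls close to the boundary; on the remaining balls
the weight is almost constant (`isMuckenhouptA1_rpow_neg_of_layers`).

The boundary is the union of three segments, whose length measure is that of intervals. It lies in
the gasket because a point of a side belongs to the half-size copy of that side at the nearer end.
-/

/-! ### Addresses -/

/-- The `j`-th barycentric coordinate, in units of `2⁻ⁿ`, of the corner from which the cell of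
level `n` with address `ω 0, …, ω (n - 1)` extends: its binary digits record where `ω` equals
`j`. -/
def corner : ℕ → (ℕ → Fin 3) → Fin 3 → ℕ
  | 0, _, _ => 0
  | n + 1, ω, j => 2 * corner n ω j + if ω n = j then 1 else 0

/-- Prepending a symbol to an address moves the corner by half the side of the triangle. -/
lemma corner_succ_cons (n : ℕ) (i : Fin 3) (ω : ℕ → Fin 3) (j : Fin 3) :
    corner (n + 1) (fun k => Nat.casesOn k i ω) j
      = (if i = j then 2 ^ n else 0) + corner n ω j := by
  induction n with
  | zero => simp [corner]
  | succ n ih =>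
    rw [corner, ih, corner]
    split_ifs <;> ring

lemma sum_corner_add_one (n : ℕ) (ω : ℕ → Fin 3) : ∑ j, corner n ω j + 1 = 2 ^ n := by
  induction n with
  | zero => simp [corner]
  | succ n ih =>
    simp only [corner, Finset.sum_add_distrib, ← Finset.mul_sum, Finset.sum_ite_eq,
      Finset.mem_univ, if_true]
    rw [pow_succ, ← ih]
    ring

/-- The corner of a cell determines its address, since the parities of the coordinates reveal
the last symbol. -/
lemma eq_of_corner_eq {n : ℕ} {ω ω' : ℕ → Fin 3} (h : ∀ j, corner n ω j = corner n ω' j) :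
    ∀ k < n, ω k = ω' k := by
  induction n with
  | zero => simp
  | succ n ih =>
    have hn : ω n = ω' n := by
      have := h (ω n)
      simp only [corner, if_true] at this
      split_ifs at this with h'
      · exact h'.symm
      · omega
    intro k hk
    rcases Nat.lt_succ_iff_lt_or_eq.mp hk with hk | rfl
    · refine ih (fun j => ?_) k hk
      have := h j
      simp only [corner, hn] at this
      omega
    · exact hn

/-- Two of the three coordinates of the corner suffice, because their sum is fixed. -/
lemma eq_of_corner_eq_of_ne {n : ℕ} {ω ω' : ℕ → Fin 3} {j k : Fin 3} (hjk : j ≠ k)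
    (hj : corner n ω j = corner n ω' j) (hk : corner n ω k = corner n ω' k) :
    ∀ i < n, ω i = ω' i := by
  refine eq_of_corner_eq fun l => ?_
  have h := sum_corner_add_one n ω
  have h' := sum_corner_add_one n ω'
  rw [Fin.sum_univ_three] at h h'
  fin_cases j <;> fin_cases k <;> fin_cases l <;> simp at hjk hj hk ⊢ <;> omega

lemma corner_congr {n : ℕ} {ω ω' : ℕ → Fin 3} (h : ∀ k < n, ω k = ω' k) (j : Fin 3) :
    corner n ω j = corner n ω' j := by
  induction n with
  | zero => rfl
  | succ n ih =>
    rw [corner, corner, ih fun k hk => h k (hk.trans n.lt_succ_self), h n n.lt_succ_self]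

/-! ### The uniform measure on addresses -/

/-- The probability measure on addresses that makes the symbols independent and uniformly
distributed. -/
noncomputable def addressMeasure : Measure (ℕ → Fin 3) :=
  Measure.infinitePi fun _ => (PMF.uniformOfFintype (Fin 3)).toMeasure

instance : IsProbabilityMeasure addressMeasure := by
  unfold addressMeasure; infer_instance

lemma setOf_eq_on_lt_eq_pi (n : ℕ) (ω : ℕ → Fin 3) :
    {ω' : ℕ → Fin 3 | ∀ k < n, ω' k = ω k} =
      Set.pi (Finset.range n : Set ℕ) fun k => {ω k} := by
  ext; simp

lemma measurableSet_setOf_eq_on_lt (n : ℕ) (ω : ℕ → Fin 3) :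
    MeasurableSet {ω' : ℕ → Fin 3 | ∀ k < n, ω' k = ω k} := by
  rw [setOf_eq_on_lt_eq_pi]
  exact MeasurableSet.pi (Finset.countable_toSet _) fun _ _ => measurableSet_singleton _

lemma addressMeasure_setOf_eq_on_lt (n : ℕ) (ω : ℕ → Fin 3) :
    addressMeasure {ω' | ∀ k < n, ω' k = ω k} = 3⁻¹ ^ n := by
  rw [setOf_eq_on_lt_eq_pi]
  refine (Measure.infinitePi_pi (μ := fun _ : ℕ => (PMF.uniformOfFintype (Fin 3)).toMeasure)
    (s := Finset.range n) (t := fun k => {ω k}) fun _ _ => measurableSet_singleton _).trans ?_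
  simp

lemma addressMeasure_corner_eq_le (n : ℕ) {j k : Fin 3} (hjk : j ≠ k) (a b : ℕ) :
    addressMeasure {ω | corner n ω j = a ∧ corner n ω k = b} ≤ 3⁻¹ ^ n := by
  rcases Set.eq_empty_or_nonempty {ω | corner n ω j = a ∧ corner n ω k = b} with h | ⟨ω₀, h⟩
  · simp [h]
  · rw [← addressMeasure_setOf_eq_on_lt n ω₀]
    exact measure_mono fun ω hω =>
      eq_of_corner_eq_of_ne hjk (hω.1.trans h.1.symm) (hω.2.trans h.2.symm)

lemma card_Icc_ceil_floor_le (u : ℝ) {A : ℝ} (hA : 0 ≤ A) :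
    ((Finset.Icc ⌈u - A⌉₊ ⌊u + A⌋₊).card : ℝ) ≤ 2 * A + 1 := by
  rw [Nat.card_Icc]
  have h1 := Nat.le_ceil (u - A)
  rcases le_or_gt ⌈u - A⌉₊ (⌊u + A⌋₊ + 1) with h | h
  · rw [Nat.cast_sub h]
    push_cast
    rcases le_or_gt 0 (u + A) with h2 | h2
    · linarith [Nat.floor_le h2]
    · rw [Nat.floor_of_nonpos h2.le]
      have : (0 : ℝ) ≤ ⌈u - A⌉₊ := Nat.cast_nonneg _
      push_cast
      linarith
  · rw [Nat.sub_eq_zero_of_le h.le]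
    push_cast
    linarith

/-- The cells of level `n` whose corner has two prescribed coordinates in intervals of lengths
`2 * A` and `2 * B` are at most `(2 * A + 1) * (2 * B + 1)` in number. -/
lemma addressMeasure_corner_mem_le (n : ℕ) {j k : Fin 3} (hjk : j ≠ k) (u v : ℝ) {A B : ℝ}
    (hA : 0 ≤ A) (hB : 0 ≤ B) :
    addressMeasure {ω | |(corner n ω j : ℝ) - u| ≤ A ∧ |(corner n ω k : ℝ) - v| ≤ B}
      ≤ ENNReal.ofReal ((2 * A + 1) * (2 * B + 1)) * 3⁻¹ ^ n := by
  set I := Finset.Icc ⌈u - A⌉₊ ⌊u + A⌋₊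
  set J := Finset.Icc ⌈v - B⌉₊ ⌊v + B⌋₊
  have hsub : {ω | |(corner n ω j : ℝ) - u| ≤ A ∧ |(corner n ω k : ℝ) - v| ≤ B} ⊆
      ⋃ p ∈ I ×ˢ J, {ω | corner n ω j = p.1 ∧ corner n ω k = p.2} := by
    rintro ω ⟨h1, h2⟩
    rw [abs_le] at h1 h2
    simp only [mem_iUnion, mem_ofPred_eq, exists_prop, Prod.exists, Finset.mem_product]
    refine ⟨_, _, ⟨?_, ?_⟩, rfl, rfl⟩ <;> rw [Finset.mem_Icc] <;>
      exact ⟨Nat.ceil_le.mpr (by linarith), Nat.le_floor (by linarith)⟩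
  calc _ ≤ _ := measure_mono hsub
    _ ≤ ∑ p ∈ I ×ˢ J, addressMeasure {ω | corner n ω j = p.1 ∧ corner n ω k = p.2} :=
      measure_biUnion_finset_le _ _
    _ ≤ ∑ _p ∈ I ×ˢ J, 3⁻¹ ^ n :=
      Finset.sum_le_sum fun p _ => addressMeasure_corner_eq_le n hjk p.1 p.2
    _ = (I.card * J.card : ℕ) * 3⁻¹ ^ n := by simp
    _ ≤ _ := by
      gcongr
      rw [← ENNReal.ofReal_natCast]
      apply ENNReal.ofReal_le_ofReal
      push_cast
      gcongr
      · exact card_Icc_ceil_floor_le u hA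
      · exact card_Icc_ceil_floor_le v hB

/-! ### Barycentric coordinates of the point with a given address -/

/-- The `j`-th barycentric coordinate of the point with address `ω`: the real number whose binary
expansion records where `ω` equals `j`. -/
noncomputable def addressCoord (ω : ℕ → Fin 3) (j : Fin 3) : ℝ :=
  Real.ofDigits (b := 2) fun k => if ω k = j then 1 else 0

lemma addressCoord_eq (n : ℕ) (ω : ℕ → Fin 3) (j : Fin 3) :
    2 ^ n * addressCoord ω j = corner n ω j + addressCoord (fun k => ω (k + n)) j := by
  have hsum : ∀ n : ℕ, 2 ^ n * ∑ i ∈ Finset.range n,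
      Real.ofDigitsTerm (b := 2) (fun k => if ω k = j then 1 else 0) i = corner n ω j := by
    intro n
    induction n with
    | zero => simp [corner]
    | succ n ih =>
      rw [Finset.sum_range_succ, mul_add, pow_succ', mul_assoc, ih, corner, Real.ofDigitsTerm]
      split_ifs <;> simp [pow_succ']
      field_simp
  rw [addressCoord, Real.ofDigits_eq_sum_add_ofDigits _ n, mul_add, hsum, addressCoord]
  simp

lemma addressCoord_nonneg (ω : ℕ → Fin 3) (j : Fin 3) : 0 ≤ addressCoord ω j :=
  Real.ofDigits_nonneg _

lemma addressCoord_le_one (ω : ℕ → Fin 3) (j : Fin 3) : addressCoord ω j ≤ 1 :=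
  Real.ofDigits_le_one _

lemma sum_addressCoord (ω : ℕ → Fin 3) : ∑ j, addressCoord ω j = 1 := by
  -- the partial sums of the three expansions add up to `1 - 2⁻ⁿ`
  have h : ∀ n : ℕ, |∑ j, addressCoord ω j - 1| ≤ 2 * (1 / 2 : ℝ) ^ n := by
    intro n
    have h1 : 2 ^ n * (∑ j, addressCoord ω j - 1)
        = ∑ j, addressCoord (fun k => ω (k + n)) j - 1 := by
      have h2 : ((∑ j, corner n ω j + 1 : ℕ) : ℝ) = 2 ^ n := by
        rw [sum_corner_add_one]; simp
      push_cast at h2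
      rw [mul_sub, Finset.mul_sum, Finset.sum_congr rfl fun j _ => addressCoord_eq n ω j,
        Finset.sum_add_distrib]
      linarith
    have h3 : |∑ j, addressCoord (fun k => ω (k + n)) j - 1| ≤ 2 := by
      have := fun j => addressCoord_nonneg (fun k => ω (k + n)) j
      have := fun j => addressCoord_le_one (fun k => ω (k + n)) j
      rw [Fin.sum_univ_three, abs_le]
      constructor <;> linarith [this 0, this 1, this 2, addressCoord_nonneg (fun k => ω (k + n)) 0,
        addressCoord_nonneg (fun k => ω (k + n)) 1, addressCoord_nonneg (fun k => ω (k + n)) 2]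
    rw [← h1, abs_mul, abs_of_pos (by positivity)] at h3
    rw [one_div, inv_pow, ← div_eq_mul_inv, le_div_iff₀ (by positivity), mul_comm]
    exact h3
  have hlim : Filter.Tendsto (fun n : ℕ => 2 * (1 / 2 : ℝ) ^ n) Filter.atTop (nhds (2 * 0)) :=
    (tendsto_pow_atTop_nhds_zero_of_lt_one (by norm_num) (by norm_num)).const_mul 2
  have := ge_of_tendsto' hlim h
  rw [mul_zero] at this
  exact sub_eq_zero.mp (abs_nonpos_iff.mp this)

lemma measurable_addressCoord (j : Fin 3) : Measurable fun ω => addressCoord ω j :=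
  Real.continuous_ofDigits.measurable.comp <| measurable_pi_lambda _ fun k =>
    (measurable_of_finite fun i : Fin 3 => if i = j then (1 : Fin 2) else 0).comp
      (measurable_pi_apply k)

/-! ### Barycentric coordinates in the triangle -/

section Coordinates

/-- The vertices of a triangle in the plane, as an affine basis. -/
noncomputable def triangleBasis (T : Affine.Triangle ℝ Plane) : AffineBasis (Fin 3) ℝ Plane :=
  ⟨T.points, T.independent, by
    rw [T.independent.affineSpan_eq_top_iff_card_eq_finrank_add_one]; simp⟩

variable (T : Affine.Triangle ℝ Plane)

@[simp] lemma triangleBasis_apply (i : Fin 3) : triangleBasis T i = T.points i := rfl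

lemma fullTriangle_eq : fullTriangle T = {x | ∀ j, 0 ≤ (triangleBasis T).coord j x} :=
  (triangleBasis T).convexHull_eq_nonneg_coord

lemma triangleBoundary_eq : triangleBoundary T =
    {x | (∀ j, 0 ≤ (triangleBasis T).coord j x) ∧ ∃ j, (triangleBasis T).coord j x = 0} := by
  have hc : IsClosed (fullTriangle T) := ((finite_range T.points).isCompact_convexHull ℝ).isClosed
  have hi : interior (fullTriangle T) = {x | ∀ j, 0 < (triangleBasis T).coord j x} :=
    (triangleBasis T).interior_convexHull
  rw [triangleBoundary, hc.frontier_eq, hi, fullTriangle_eq]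
  ext x
  simp only [mem_sdiff, mem_ofPred_eq, not_forall, not_lt]
  exact and_congr_right fun h => exists_congr fun j =>
    ⟨fun h' => h'.antisymm (h j), fun h' => h'.le⟩

lemma coord_midpoint (i j : Fin 3) (x : Plane) :
    (triangleBasis T).coord j (midpoint ℝ (T.points i) x)
      = ((if i = j then 1 else 0) + (triangleBasis T).coord j x) / 2 := by
  rw [AffineMap.map_midpoint, ← triangleBasis_apply, AffineBasis.coord_apply, midpoint_eq_smul_add]
  simp only [eq_comm (a := j), smul_eq_mul, invOf_eq_inv]
  ring

lemma ext_coord {x y : Plane}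
    (h : ∀ j, (triangleBasis T).coord j x = (triangleBasis T).coord j y) : x = y := by
  rw [← (triangleBasis T).linear_combination_coord_eq_self x,
    ← (triangleBasis T).linear_combination_coord_eq_self y]
  simp [h]

lemma exists_abs_coord_sub_le : ∃ K : ℝ, 0 ≤ K ∧ ∀ (j : Fin 3) (x y : Plane),
    |(triangleBasis T).coord j x - (triangleBasis T).coord j y| ≤ K * dist x y := by
  have key : ∀ j : Fin 3, ∃ K : ℝ, 0 ≤ K ∧ ∀ x y : Plane,
      |(triangleBasis T).coord j x - (triangleBasis T).coord j y| ≤ K * dist x y := by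
    intro j
    refine ⟨‖LinearMap.toContinuousLinearMap ((triangleBasis T).coord j).linear‖, norm_nonneg _,
      fun x y => ?_⟩
    rw [dist_eq_norm, ← vsub_eq_sub, ← AffineMap.linearMap_vsub, ← Real.norm_eq_abs]
    exact (LinearMap.toContinuousLinearMap ((triangleBasis T).coord j).linear).le_opNorm (x -ᵥ y)
  choose K hK h using key
  refine ⟨∑ j, K j, Finset.sum_nonneg fun j _ => hK j, fun j x y => (h j x y).trans ?_⟩
  gcongr
  exact Finset.single_le_sum (fun j _ => hK j) (Finset.mem_univ j)

/-- The radius at scale `0`: a number exceeding the diameter of the triangle. -/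
noncomputable def baseRadius : ℝ := 1 + ∑ j, ‖T.points j‖

lemma baseRadius_pos : 0 < baseRadius T := by
  unfold baseRadius; positivity

/-- The dyadic scale attached to cells of level `n`. -/
noncomputable def scale (n : ℕ) : ℝ := baseRadius T / 2 ^ n

lemma scale_pos (n : ℕ) : 0 < scale T n := div_pos (baseRadius_pos T) (by positivity)

lemma two_pow_mul_scale (n : ℕ) : 2 ^ n * scale T n = baseRadius T := by
  unfold scale; field_simp

lemma dist_lt_scale {x y : Plane} {n : ℕ} (h : ∀ j, 2 ^ n *
    |(triangleBasis T).coord j x - (triangleBasis T).coord j y| ≤ 1) : dist x y < scale T n := by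
  have h1 : ∀ j, |(triangleBasis T).coord j x - (triangleBasis T).coord j y| ≤ 1 / 2 ^ n := by
    intro j
    rw [le_div_iff₀ (by positivity), mul_comm]
    exact h j
  have h2 : x - y = ∑ j, ((triangleBasis T).coord j x - (triangleBasis T).coord j y)
      • T.points j := by
    simp only [sub_smul, Finset.sum_sub_distrib, ← triangleBasis_apply,
      AffineBasis.linear_combination_coord_eq_self]
  calc dist x y ≤ ∑ j, 1 / 2 ^ n * ‖T.points j‖ := by
        rw [dist_eq_norm, h2]
        refine (norm_sum_le _ _).trans (Finset.sum_le_sum fun j _ => ?_)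
        rw [norm_smul, Real.norm_eq_abs]
        gcongr
        exact h1 j
    _ < scale T n := by
        rw [← Finset.mul_sum, scale, baseRadius, div_mul_eq_mul_div, one_mul]
        gcongr
        linarith

/-! ### Cells of the gasket -/

/-- The triangle of level `n` with address `ω 0, …, ω (n - 1)`, in barycentric coordinates. -/
def cell (n : ℕ) (ω : ℕ → Fin 3) : Set Plane :=
  {x | ∀ j, (corner n ω j : ℝ) ≤ 2 ^ n * (triangleBasis T).coord j x ∧
    2 ^ n * (triangleBasis T).coord j x ≤ corner n ω j + 1}

variable {T}

lemma cell_succ_subset (n : ℕ) (ω : ℕ → Fin 3) : cell T (n + 1) ω ⊆ cell T n ω := by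
  intro x hx j
  have h := hx j
  rw [corner, pow_succ] at h
  push_cast at h
  split_ifs at h <;> constructor <;> linarith

lemma cell_anti (ω : ℕ → Fin 3) : Antitone fun n => cell T n ω :=
  antitone_nat_of_succ_le fun n => cell_succ_subset n ω

lemma cell_congr {n : ℕ} {ω ω' : ℕ → Fin 3} (h : ∀ k < n, ω k = ω' k) :
    cell T n ω = cell T n ω' := by
  simp only [cell, corner_congr h]

lemma dist_lt_scale_of_mem_cell {n : ℕ} {ω : ℕ → Fin 3} {x y : Plane} (hx : x ∈ cell T n ω)
    (hy : y ∈ cell T n ω) : dist x y < scale T n := by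
  refine dist_lt_scale T fun j => ?_
  rw [← abs_of_pos (a := (2 : ℝ) ^ n) (by positivity), ← abs_mul, mul_sub, abs_le]
  constructor <;> linarith [(hx j).1, (hx j).2, (hy j).1, (hy j).2]

lemma exists_mem_cell_of_mem_gasketStep {n : ℕ} {x : Plane} (hx : x ∈ gasketStep T n) :
    ∃ ω, x ∈ cell T n ω := by
  induction n generalizing x with
  | zero =>
    rw [gasketStep, fullTriangle_eq] at hx
    refine ⟨fun _ => 0, fun j => ?_⟩
    have h1 := (triangleBasis T).sum_coord_apply_eq_one x
    have h2 := Finset.single_le_sum (fun j _ => hx j) (Finset.mem_univ j)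
    have h3 := hx j
    simp only [corner, pow_zero, one_mul, Nat.cast_zero, zero_add]
    exact ⟨h3, h2.trans h1.le⟩
  | succ n ih =>
    obtain ⟨i, y, hy, rfl⟩ := mem_iUnion.mp hx
    obtain ⟨ω, hω⟩ := ih hy
    refine ⟨fun k => Nat.casesOn k i ω, fun j => ?_⟩
    rw [corner_succ_cons, coord_midpoint, pow_succ]
    have := hω j
    push_cast
    split_ifs <;> constructor <;> linarith

lemma exists_mem_cell {x : Plane} (hx : x ∈ sierpinskiGasket T) (n : ℕ) : ∃ ω, x ∈ cell T n ω :=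
  exists_mem_cell_of_mem_gasketStep (mem_iInter.mp hx n)

variable (T)

/-- The point of the gasket with address `ω`. -/
noncomputable def addressPoint (ω : ℕ → Fin 3) : Plane := ∑ j, addressCoord ω j • T.points j

lemma coord_addressPoint (ω : ℕ → Fin 3) (j : Fin 3) :
    (triangleBasis T).coord j (addressPoint T ω) = addressCoord ω j := by
  have h := (triangleBasis T).coord_apply_combination_of_mem (Finset.mem_univ j)
    (sum_addressCoord ω)
  rwa [Finset.affineCombination_eq_linear_combination _ _ _ (sum_addressCoord ω)] at h

lemma addressPoint_mem_cell (n : ℕ) (ω : ℕ → Fin 3) : addressPoint T ω ∈ cell T n ω := by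
  intro j
  rw [coord_addressPoint, addressCoord_eq]
  constructor <;> linarith [addressCoord_nonneg (fun k => ω (k + n)) j,
    addressCoord_le_one (fun k => ω (k + n)) j]

lemma addressPoint_mem_gasket (ω : ℕ → Fin 3) : addressPoint T ω ∈ sierpinskiGasket T := by
  refine mem_iInter.mpr fun n => ?_
  induction n generalizing ω with
  | zero =>
    rw [gasketStep, fullTriangle_eq]
    intro j
    rw [coord_addressPoint]
    exact addressCoord_nonneg _ _
  | succ n ih =>
    refine mem_iUnion.mpr ⟨ω 0, _, ih fun k => ω (k + 1), ext_coord T fun j => ?_⟩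
    have := addressCoord_eq 1 ω j
    rw [coord_midpoint, coord_addressPoint, coord_addressPoint]
    simp only [corner, mul_zero, zero_add, pow_one] at this
    push_cast at this
    rw [← this]
    ring

lemma measurable_addressPoint : Measurable (addressPoint T) :=
  Finset.measurable_sum _ fun j _ => (measurable_addressCoord j).smul_const _

end Coordinates

/-! ### Counting cells -/

section Counting

/-- A Lipschitz constant of the barycentric coordinates. -/
noncomputable def coordLip (T : Affine.Triangle ℝ Plane) : ℝ := (exists_abs_coord_sub_le T).choose

variable (T : Affine.Triangle ℝ Plane)

lemma coordLip_nonneg : 0 ≤ coordLip T := (exists_abs_coord_sub_le T).choose_spec.1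

lemma abs_coord_sub_le (j : Fin 3) (x y : Plane) :
    |(triangleBasis T).coord j x - (triangleBasis T).coord j y| ≤ coordLip T * dist x y :=
  (exists_abs_coord_sub_le T).choose_spec.2 j x y

/-- A bound for the number of cells of level `n` that meet a ball of radius `scale T n`. -/
noncomputable def cellCount : ℝ := (2 * (coordLip T * baseRadius T) + 3) ^ 2

lemma coordLip_mul_baseRadius_nonneg : 0 ≤ coordLip T * baseRadius T :=
  mul_nonneg (coordLip_nonneg T) (baseRadius_pos T).le

lemma cellCount_pos : 0 < cellCount T := by
  have := coordLip_mul_baseRadius_nonneg T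
  unfold cellCount; positivity

variable {T}

lemma abs_corner_sub_le {m k : ℕ} {ω : ℕ → Fin 3} {x z : Plane} (hx : x ∈ cell T (m + k) ω)
    (hz : dist x z ≤ scale T m) (j : Fin 3) :
    |(corner (m + k) ω j : ℝ) - 2 ^ (m + k) * (triangleBasis T).coord j z|
      ≤ coordLip T * baseRadius T * 2 ^ k + 1 := by
  have h1 : 2 ^ (m + k) * |(triangleBasis T).coord j x - (triangleBasis T).coord j z|
      ≤ coordLip T * baseRadius T * 2 ^ k := by
    calc _ ≤ 2 ^ (m + k) * (coordLip T * scale T m) := by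
          have := coordLip_nonneg T
          gcongr
          exact (abs_coord_sub_le T j x z).trans (by gcongr)
      _ = _ := by rw [pow_add, ← two_pow_mul_scale T m]; ring
  rw [← abs_of_pos (a := (2 : ℝ) ^ (m + k)) (by positivity), ← abs_mul, mul_sub, abs_le] at h1
  rw [abs_le]
  constructor <;> linarith [(hx j).1, (hx j).2]

lemma addressMeasure_meets_le {E : Set Plane} {z : Plane} {n : ℕ}
    (hE : E ⊆ closedBall z (scale T n)) :
    addressMeasure {ω | (E ∩ cell T n ω).Nonempty} ≤ ENNReal.ofReal (cellCount T) * 3⁻¹ ^ n := by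
  have hA := coordLip_mul_baseRadius_nonneg T
  have h := addressMeasure_corner_mem_le n (zero_ne_one (α := Fin 3))
    (2 ^ n * (triangleBasis T).coord 0 z) (2 ^ n * (triangleBasis T).coord 1 z)
    (A := coordLip T * baseRadius T + 1) (B := coordLip T * baseRadius T + 1)
    (by positivity) (by positivity)
  refine (measure_mono ?_).trans (h.trans_eq ?_)
  · rintro ω ⟨x, hxE, hx⟩
    constructor <;> simpa using abs_corner_sub_le (k := 0) hx (hE hxE) _
  · rw [cellCount]; ring_nf

/-- Near one side of the triangle, the number of cells of level `m + k` in a ball of radius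
`scale T m` grows like `2 ^ k` only: one barycentric coordinate of their corners is bounded, and
another ranges over an interval of length comparable to `2 ^ k`. -/
lemma addressMeasure_meets_layer_le {E : Set Plane} {z : Plane} {m k : ℕ}
    (hE : E ⊆ closedBall z (scale T m))
    (hj : ∀ x ∈ E, ∃ j, (triangleBasis T).coord j x ≤ coordLip T * scale T (m + k)) :
    addressMeasure {ω | (E ∩ cell T (m + k) ω).Nonempty}
      ≤ ENNReal.ofReal (3 * cellCount T) * (2 ^ k * 3⁻¹ ^ (m + k)) := by
  set A := coordLip T * baseRadius T with hAdef
  have hA : 0 ≤ A := coordLip_mul_baseRadius_nonneg T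
  have hsub : {ω | (E ∩ cell T (m + k) ω).Nonempty} ⊆ ⋃ j : Fin 3,
      {ω | |(corner (m + k) ω j : ℝ) - 0| ≤ A ∧ |(corner (m + k) ω (j + 1) : ℝ) -
        2 ^ (m + k) * (triangleBasis T).coord (j + 1) z| ≤ A * 2 ^ k + 1} := by
    rintro ω ⟨x, hxE, hx⟩
    obtain ⟨j, hjx⟩ := hj x hxE
    refine mem_iUnion.mpr ⟨j, ?_, abs_corner_sub_le hx (hE hxE) _⟩
    rw [sub_zero, Nat.abs_cast, hAdef, ← two_pow_mul_scale T (m + k)]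
    refine (hx j).1.trans ?_
    calc _ ≤ 2 ^ (m + k) * (coordLip T * scale T (m + k)) := by gcongr
      _ = _ := by ring
  calc _ ≤ _ := measure_mono hsub
    _ ≤ _ := measure_iUnion_le _
    _ ≤ ∑' _j : Fin 3, ENNReal.ofReal (cellCount T * 2 ^ k) * 3⁻¹ ^ (m + k) := by
      refine ENNReal.tsum_le_tsum fun j => ?_
      refine (addressMeasure_corner_mem_le (m + k) (j := j) (k := j + 1) (by fin_cases j <;> decide)
        _ _ hA (by positivity)).trans ?_
      refine mul_le_mul_left (ENNReal.ofReal_le_ofReal ?_) _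
      rw [cellCount, ← hAdef]
      have h2 : (1 : ℝ) ≤ 2 ^ k := one_le_pow₀ (by norm_num)
      calc (2 * A + 1) * (2 * (A * 2 ^ k + 1) + 1)
          ≤ (2 * A + 3) * (2 * (A * 2 ^ k + 2 ^ k) + 2 ^ k) := by gcongr; norm_num
        _ = _ := by ring
    _ = _ := by
      rw [tsum_fintype, Finset.sum_const, Finset.card_univ, Fintype.card_fin, nsmul_eq_mul,
        ENNReal.ofReal_mul (cellCount_pos T).le, ENNReal.ofReal_mul (by norm_num : (0 : ℝ) ≤ 3),
        ENNReal.ofReal_pow (by norm_num)]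
      simp
      ring

/-! ### Hausdorff measure of subsets of the gasket -/

lemma exists_div_two_pow_lt_le {M r : ℝ} (hr : 0 < r) (hr' : r ≤ M) :
    ∃ n : ℕ, M / 2 ^ (n + 1) < r ∧ r ≤ M / 2 ^ n := by
  have hM := hr.trans_le hr'
  obtain ⟨n, h1, h2⟩ := exists_nat_pow_near_of_lt_one (div_pos hr hM)
    ((div_le_one hM).mpr hr') (one_half_pos (α := ℝ)) one_half_lt_one
  rw [lt_div_iff₀ hM] at h1
  rw [div_le_iff₀ hM] at h2
  rw [div_pow, one_pow, one_div_mul_eq_div] at h1 h2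
  exact ⟨n, h1, h2⟩

lemma tendsto_ofReal_div_two_pow (M : ℝ) :
    Filter.Tendsto (fun n : ℕ => ENNReal.ofReal (M / 2 ^ n)) Filter.atTop (nhds 0) := by
  have h := (tendsto_pow_atTop_nhds_zero_of_lt_one (r := (1 / 2 : ℝ)) (by norm_num)
    (by norm_num)).const_mul M
  simp only [mul_zero, div_pow, one_pow, mul_one_div] at h
  simpa using ENNReal.tendsto_ofReal h

lemma ofReal_div_two_pow (M : ℝ) (n : ℕ) :
    ENNReal.ofReal (M / 2 ^ n) = ENNReal.ofReal M * 2⁻¹ ^ n := by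
  rw [ENNReal.ofReal_div_of_pos (by positivity), ENNReal.ofReal_pow (by norm_num),
    ENNReal.ofReal_ofNat, ENNReal.div_eq_inv_mul, mul_comm, ENNReal.inv_pow]

variable {α : ℝ}

lemma ofReal_scale_rpow (hα : (2 : ℝ≥0∞) ^ α = 3) (hα0 : 0 ≤ α) (n : ℕ) :
    ENNReal.ofReal (scale T n) ^ α = ENNReal.ofReal (baseRadius T) ^ α * 3⁻¹ ^ n := by
  rw [scale, ofReal_div_two_pow, ENNReal.mul_rpow_of_nonneg _ _ hα0, ← hα, ← ENNReal.inv_rpow,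
    ← ENNReal.rpow_natCast, ← ENNReal.rpow_mul, ← ENNReal.rpow_natCast, ← ENNReal.rpow_mul,
    mul_comm α]

/-- Covering by the cells of a high level that meet `E` bounds the Hausdorff measure by the
measure of the addresses whose cell of level `n` meets `E`. -/
lemma hausdorffMeasure_le_addressMeasure (hα : (2 : ℝ≥0∞) ^ α = 3) (hα0 : 0 < α) {E : Set Plane}
    (hE : E ⊆ sierpinskiGasket T) (n : ℕ) :
    Measure.hausdorffMeasure α E ≤ ENNReal.ofReal (baseRadius T) ^ α *
      addressMeasure {ω | (E ∩ cell T n ω).Nonempty} := by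
  classical
  let pad : ∀ m : ℕ, (Fin m → Fin 3) → ℕ → Fin 3 := fun m w k => if h : k < m then w ⟨k, h⟩ else 0
  have hdiam : ∀ m (ω : ℕ → Fin 3), ediam (E ∩ cell T m ω) ≤ ENNReal.ofReal (scale T m) := by
    intro m ω
    refine ediam_le fun x hx y hy => ?_
    rw [edist_dist]
    exact ENNReal.ofReal_le_ofReal (dist_lt_scale_of_mem_cell hx.2 hy.2).le
  have hcov : ∀ m, E ⊆ ⋃ w : Fin m → Fin 3, E ∩ cell T m (pad m w) := by
    intro m x hx
    obtain ⟨ω, hω⟩ := exists_mem_cell (hE hx) m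
    refine mem_iUnion.mpr ⟨fun k => ω k, hx, ?_⟩
    rwa [cell_congr (ω' := ω) fun k hk => by simp [pad, hk]]
  refine (Measure.hausdorffMeasure_le_liminf_sum α E _ (tendsto_ofReal_div_two_pow (baseRadius T))
    (fun m (w : Fin m → Fin 3) => E ∩ cell T m (pad m w))
    (Filter.Eventually.of_forall fun m w => hdiam m _)
    (Filter.Eventually.of_forall hcov)).trans ?_
  refine (Filter.liminf_le_liminf (v := fun _ => ENNReal.ofReal (baseRadius T) ^ α *
      addressMeasure {ω | (E ∩ cell T n ω).Nonempty}) ?_).trans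
    (Filter.liminf_const _).le
  filter_upwards [Filter.eventually_ge_atTop n] with m hm
  set W := Finset.univ.filter fun w : Fin m → Fin 3 => (E ∩ cell T m (pad m w)).Nonempty
  calc ∑ w : Fin m → Fin 3, ediam (E ∩ cell T m (pad m w)) ^ α
      = ∑ w ∈ W, ediam (E ∩ cell T m (pad m w)) ^ α := by
        refine (Finset.sum_subset (Finset.subset_univ W) fun w _ hw => ?_).symm
        have : E ∩ cell T m (pad m w) = ∅ := by simpa [W, Set.not_nonempty_iff_eq_empty] using hw
        rw [this, ediam_empty, ENNReal.zero_rpow_of_pos hα0]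
    _ ≤ ∑ w ∈ W, ENNReal.ofReal (baseRadius T) ^ α *
          addressMeasure {ω | ∀ k < m, ω k = pad m w k} := by
        refine Finset.sum_le_sum fun w _ => ?_
        rw [addressMeasure_setOf_eq_on_lt, ← ofReal_scale_rpow hα hα0.le]
        gcongr
        exact hdiam m _
    _ = ENNReal.ofReal (baseRadius T) ^ α *
          addressMeasure (⋃ w ∈ W, {ω | ∀ k < m, ω k = pad m w k}) := by
        rw [← Finset.mul_sum, measure_biUnion_finset _ fun w _ => measurableSet_setOf_eq_on_lt _ _]
        intro w _ w' _ hww'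
        refine Set.disjoint_left.mpr fun ω h h' => hww' (funext fun k => ?_)
        have := (h k k.2).symm.trans (h' k k.2)
        simpa [pad] using this
    _ ≤ _ := by
        gcongr
        refine iUnion₂_subset fun w hw ω hω => ?_
        obtain ⟨x, hxE, hx⟩ := (Finset.mem_filter.mp hw).2
        rw [← cell_congr hω] at hx
        exact ⟨x, hxE, cell_anti ω hm hx⟩

/-- The mass distribution principle for the image of the uniform measure on addresses. -/
lemma exists_map_addressMeasure_le (hα : (2 : ℝ≥0∞) ^ α = 3) (hα0 : 0 < α) :
    ∃ c : ℝ≥0∞, c ≠ 0 ∧ c ≠ ∞ ∧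
      c • addressMeasure.map (addressPoint T) ≤ Measure.hausdorffMeasure α := by
  have hM := baseRadius_pos T
  set a := ENNReal.ofReal (baseRadius T) ^ α
  have ha0 : a ≠ 0 := (ENNReal.rpow_pos (by simpa using hM) ENNReal.ofReal_ne_top).ne'
  have hat : a ≠ ∞ := ENNReal.rpow_ne_top_of_nonneg hα0.le ENNReal.ofReal_ne_top
  set N := ENNReal.ofReal (cellCount T)
  have hN0 : N ≠ 0 := by simpa [N] using cellCount_pos T
  have hNt : N ≠ ∞ := ENNReal.ofReal_ne_top
  -- a set of diameter at most `scale T n` has mass at most `N * 3⁻¹ ^ n`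
  have key : ∀ (s : Set Plane) (n : ℕ), ediam s ≤ ENNReal.ofReal (scale T n) →
      addressMeasure.map (addressPoint T) s ≤ N * 3⁻¹ ^ n := by
    intro s n hs
    rcases s.eq_empty_or_nonempty with rfl | ⟨z, hz⟩
    · simp
    calc _ ≤ addressMeasure.map (addressPoint T) (closure s) := measure_mono subset_closure
      _ = addressMeasure (addressPoint T ⁻¹' closure s) :=
        Measure.map_apply (measurable_addressPoint T) isClosed_closure.measurableSet
      _ ≤ addressMeasure {ω | (closure s ∩ cell T n ω).Nonempty} :=
        measure_mono fun ω hω => ⟨_, hω, addressPoint_mem_cell T n ω⟩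
      _ ≤ _ := by
        refine addressMeasure_meets_le (z := z) fun x hx => ?_
        have h := edist_le_ediam_of_mem hx (subset_closure hz)
        rw [ediam_closure] at h
        rw [mem_closedBall, ← ENNReal.ofReal_le_ofReal_iff (scale_pos T n).le, ← edist_dist]
        exact h.trans hs
  refine ⟨a * (3 * N)⁻¹, mul_ne_zero ha0 (ENNReal.inv_ne_zero.mpr
    (ENNReal.mul_ne_top (by norm_num) hNt)), ENNReal.mul_ne_top hat (ENNReal.inv_ne_top.mpr
    (mul_ne_zero (by norm_num) hN0)), ?_⟩
  refine Measure.le_hausdorffMeasure α _ (ENNReal.ofReal (baseRadius T)) (by simpa using hM)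
    fun s hs => ?_
  rw [Measure.smul_apply, smul_eq_mul]
  rcases eq_or_ne (ediam s) 0 with h0 | h0
  · have hlim : Filter.Tendsto (fun n : ℕ => N * (3⁻¹ : ℝ≥0∞) ^ n) Filter.atTop (nhds (N * 0)) :=
      ENNReal.Tendsto.const_mul (ENNReal.tendsto_pow_atTop_nhds_zero_of_lt_one (by simp))
        (Or.inr hNt)
    have h := ge_of_tendsto' hlim fun n => key s n (by simp [h0])
    rw [mul_zero, nonpos_iff_eq_zero] at h
    rw [h, mul_zero]
    exact zero_le
  · have hst : ediam s ≠ ∞ := ne_top_of_le_ne_top ENNReal.ofReal_ne_top hs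
    obtain ⟨n, h1, h2⟩ := exists_div_two_pow_lt_le (M := baseRadius T) (ENNReal.toReal_pos h0 hst)
      (ENNReal.toReal_le_of_le_ofReal hM.le hs)
    have h3 := key s n ((ENNReal.le_ofReal_iff_toReal_le hst (scale_pos T n).le).mpr h2)
    have h4 : a * 3⁻¹ ^ (n + 1) ≤ ediam s ^ α := by
      rw [← ofReal_scale_rpow hα hα0.le]
      gcongr
      exact (ENNReal.ofReal_lt_iff_lt_toReal (scale_pos T _).le hst).mpr h1 |>.le
    refine le_trans ?_ h4
    calc _ ≤ a * (3 * N)⁻¹ * (N * 3⁻¹ ^ n) := by gcongr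
      _ = a * ((3⁻¹ * 3⁻¹ ^ n) * (N⁻¹ * N)) := by
        rw [ENNReal.mul_inv (Or.inl (by norm_num)) (Or.inl (by norm_num))]; ring
      _ = _ := by rw [ENNReal.inv_mul_cancel hN0 hNt, mul_one, pow_succ']

end Counting

/-! ### From layer estimates to the Muckenhoupt condition -/

lemma ENNReal.rpow_neg_anti {a b : ℝ≥0∞} {s : ℝ} (hs : 0 ≤ s) (h : a ≤ b) :
    b ^ (-s) ≤ a ^ (-s) := by
  rw [ENNReal.rpow_neg, ENNReal.rpow_neg]
  exact ENNReal.inv_le_inv.mpr (ENNReal.rpow_le_rpow h hs)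

/-- A negative power of `d` is dominated by a step function over the dyadic layers of `d`. -/
lemma rpow_neg_le_tsum_layers {X : Type*} {M s : ℝ} (hM : 0 < M) (hs : 0 ≤ s) (m : ℕ)
    (d : X → ℝ≥0∞) (y : X) :
    d y ^ (-s) ≤ ENNReal.ofReal (M / 2 ^ m) ^ (-s) +
      ∑' k : ℕ, {x | d x < ENNReal.ofReal (M / 2 ^ (m + k))}.indicator
        (fun _ => ENNReal.ofReal (M / 2 ^ (m + k + 1)) ^ (-s)) y := by
  set R : ℕ → ℝ≥0∞ := fun n => ENNReal.ofReal (M / 2 ^ n) with hR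
  change d y ^ (-s) ≤ R m ^ (-s) + ∑' k : ℕ, {x | d x < R (m + k)}.indicator
        (fun _ => R (m + k + 1) ^ (-s)) y
  rcases le_or_gt (R m) (d y) with h | h
  · exact (ENNReal.rpow_neg_anti hs h).trans le_self_add
  refine le_trans ?_ le_add_self
  rcases eq_or_ne (d y) 0 with h0 | h0
  · -- the point lies in every layer, so that the sum is infinite
    have hpos : R m ^ (-s) ≠ 0 := by
      rw [ENNReal.rpow_neg]
      exact ENNReal.inv_ne_zero.mpr (ENNReal.rpow_ne_top_of_nonneg hs ENNReal.ofReal_ne_top)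
    refine le_top.trans_eq ((ENNReal.tsum_const_eq_top_of_ne_zero hpos).symm) |>.trans
      (ENNReal.tsum_le_tsum fun k => ?_)
    have hmem : y ∈ {x | d x < R (m + k)} := by
      simp only [mem_ofPred_eq, h0, hR, ENNReal.ofReal_pos]; positivity
    rw [indicator_of_mem hmem]
    refine ENNReal.rpow_neg_anti hs (ENNReal.ofReal_le_ofReal ?_)
    gcongr
    · norm_num
    · omega
  · have hex : ∃ k, R (m + k + 1) ≤ d y := by
      have h1 := ((tendsto_ofReal_div_two_pow M).eventually_le_const
        (pos_iff_ne_zero.mpr h0)).and (Filter.eventually_ge_atTop (m + 1))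
      obtain ⟨n, h2, h3⟩ := h1.exists
      exact ⟨n - (m + 1), by rwa [show m + (n - (m + 1)) + 1 = n by omega]⟩
    classical
    set k := Nat.find hex with hk
    have hmem : y ∈ {x | d x < R (m + k)} := by
      rcases hk' : k with _ | k'
      · simpa using h
      · exact not_le.mp (Nat.find_min hex (m := k') (by omega))
    refine le_trans ?_ (ENNReal.le_tsum k)
    rw [indicator_of_mem hmem]
    exact ENNReal.rpow_neg_anti hs (Nat.find_spec hex)

section Layers

variable {X : Type*} [MetricSpace X]

lemma exists_ball_subset_ball_subset {M : ℝ} (hM : 0 < M) (hX : ∀ x y : X, dist x y < M) (z : X)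
    {r : ℝ} (hr : 0 < r) :
    ∃ m : ℕ, ball z (M / 2 ^ (m + 1)) ⊆ ball z r ∧ ball z r ⊆ ball z (M / 2 ^ m) := by
  rcases le_total r M with h | h
  · obtain ⟨n, h1, h2⟩ := exists_div_two_pow_lt_le hr h
    exact ⟨n, ball_subset_ball h1.le, ball_subset_ball h2⟩
  · refine ⟨0, ball_subset_ball (le_trans ?_ h), fun x _ => ?_⟩
    · exact div_le_self hM.le (one_le_pow₀ (by norm_num))
    · simpa using hX x z

variable [MeasurableSpace X]

/-- The integral of a negative power of `d` over a ball of radius `M / 2 ^ m`. The geometric series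
of ratio `2 ^ (1 + s) / 3` bounds the contributions of the dyadic layers of `d`. -/
lemma setLIntegral_rpow_neg_le_of_layers {μ : Measure X} {d : X → ℝ≥0∞} (hd : Measurable d)
    {M s : ℝ} (hM : 0 < M) (hs : 0 ≤ s) {C D : ℝ≥0∞} (z : X) (m : ℕ)
    (hup : μ (ball z (M / 2 ^ m)) ≤ C * 3⁻¹ ^ m)
    (hlayer : ∀ k : ℕ, μ ({x | d x < ENNReal.ofReal (M / 2 ^ (m + k))} ∩ ball z (M / 2 ^ m)) ≤
      D * (2 ^ k * 3⁻¹ ^ (m + k))) :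
    ∫⁻ y in ball z (M / 2 ^ m), d y ^ (-s) ∂μ ≤
      (C + D * 2 ^ s * (1 - 2 * 2 ^ s * 3⁻¹)⁻¹) *
        (3⁻¹ ^ m * ENNReal.ofReal (M / 2 ^ m) ^ (-s)) := by
  have hscale : ∀ k, ENNReal.ofReal (M / 2 ^ (m + k + 1)) ^ (-s) =
      ENNReal.ofReal (M / 2 ^ m) ^ (-s) * (2 ^ s) ^ (k + 1) := by
    intro k
    rw [add_assoc, pow_add, ← div_div, ofReal_div_two_pow _ (k + 1),
      ENNReal.mul_rpow_of_ne_top ENNReal.ofReal_ne_top (by simp), ← ENNReal.rpow_natCast,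
      ← ENNReal.rpow_mul, mul_comm, mul_comm _ (-s), ENNReal.rpow_mul, ENNReal.inv_rpow,
      ENNReal.rpow_neg, inv_inv, ENNReal.rpow_natCast, mul_comm]
  have hA : ∀ k : ℕ, MeasurableSet {x | d x < ENNReal.ofReal (M / 2 ^ (m + k))} :=
    fun k => hd measurableSet_Iio
  calc _ ≤ ∫⁻ y in ball z (M / 2 ^ m), (ENNReal.ofReal (M / 2 ^ m) ^ (-s) +
      ∑' k : ℕ, {x | d x < ENNReal.ofReal (M / 2 ^ (m + k))}.indicator
        (fun _ => ENNReal.ofReal (M / 2 ^ (m + k + 1)) ^ (-s)) y) ∂μ :=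
        lintegral_mono fun y => rpow_neg_le_tsum_layers hM hs m d y
    _ = ENNReal.ofReal (M / 2 ^ m) ^ (-s) * μ (ball z (M / 2 ^ m)) +
        ∑' k : ℕ, ENNReal.ofReal (M / 2 ^ (m + k + 1)) ^ (-s) *
          μ ({x | d x < ENNReal.ofReal (M / 2 ^ (m + k))} ∩ ball z (M / 2 ^ m)) := by
      rw [lintegral_add_left measurable_const, lintegral_const, Measure.restrict_apply_univ,
        lintegral_tsum fun k => (measurable_const.indicator (hA k)).aemeasurable]
      congr 2
      ext k
      rw [lintegral_indicator (hA k), lintegral_const, Measure.restrict_apply_univ,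
        Measure.restrict_apply (hA k)]
    _ ≤ ENNReal.ofReal (M / 2 ^ m) ^ (-s) * (C * 3⁻¹ ^ m) +
        ∑' k : ℕ, (D * 2 ^ s * (3⁻¹ ^ m * ENNReal.ofReal (M / 2 ^ m) ^ (-s))) *
          (2 * 2 ^ s * 3⁻¹) ^ k := by
      refine add_le_add (mul_le_mul_right hup _) (ENNReal.tsum_le_tsum fun k => ?_)
      rw [hscale]
      refine (mul_le_mul_right (hlayer k) _).trans_eq ?_
      simp only [mul_pow, pow_add]
      ring
    _ = _ := by
      rw [ENNReal.tsum_mul_left, ENNReal.tsum_geometric]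
      ring

/-- Let the balls of radius `M / 2 ^ n` have measure comparable to `3⁻¹ ^ n`, and let the layers of
thickness `M / 2 ^ (m + k)` of the distance function `d` occupy at most a multiple of
`2 ^ k * 3⁻¹ ^ (m + k)` of each ball of radius `M / 2 ^ m`. Then `d ^ (-s)` is an `A₁` weight as
long as `2 ^ (1 + s) < 3`. In a ball that is small compared with the value of `d` at its
centre the weight is almost constant; in other balls the layer estimate applies. -/
theorem isMuckenhouptA1_rpow_neg_of_layers [OpensMeasurableSpace X] {μ : Measure X}
    {d : X → ℝ≥0∞} (hd : Measurable d) (hd_top : ∀ x, d x ≠ ∞)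
    (hd_lip : ∀ x y, d x ≤ d y + edist x y)
    {M s : ℝ} (hM : 0 < M) (hX : ∀ x y : X, dist x y < M)
    (hs : 0 ≤ s) (hs' : 2 * (2 : ℝ≥0∞) ^ s < 3) {c C D : ℝ≥0∞} (hc : c ≠ 0) (hC : C ≠ ∞)
    (hD : D ≠ ∞) (hlow : ∀ (z : X) (n : ℕ), c * 3⁻¹ ^ n ≤ μ (ball z (M / 2 ^ n)))
    (hup : ∀ (z : X) (n : ℕ), μ (ball z (M / 2 ^ n)) ≤ C * 3⁻¹ ^ n)
    (hlayer : ∀ (z : X) (m k : ℕ),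
      μ ({x | d x < ENNReal.ofReal (M / 2 ^ (m + k))} ∩ ball z (M / 2 ^ m)) ≤
        D * (2 ^ k * 3⁻¹ ^ (m + k))) :
    IsMuckenhouptA1 μ fun x => d x ^ (-s) := by
  set K := C + D * 2 ^ s * (1 - 2 * 2 ^ s * 3⁻¹)⁻¹ with hKdef
  have h2s : (2 : ℝ≥0∞) ^ s ≠ ∞ := ENNReal.rpow_ne_top_of_nonneg hs (by norm_num)
  have h3s : (3 : ℝ≥0∞) ^ s ≠ ∞ := ENNReal.rpow_ne_top_of_nonneg hs (by norm_num)
  have h4s : (4 : ℝ≥0∞) ^ s ≠ ∞ := ENNReal.rpow_ne_top_of_nonneg hs (by norm_num)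
  have hK : K ≠ ∞ := by
    refine ENNReal.add_ne_top.mpr ⟨hC, ENNReal.mul_ne_top (ENNReal.mul_ne_top hD h2s) ?_⟩
    refine ENNReal.inv_ne_top.mpr (tsub_pos_of_lt ?_).ne'
    rw [← div_eq_mul_inv]
    exact ENNReal.div_lt_of_lt_mul' (by simpa using hs')
  have hR0 : ∀ m : ℕ, ENNReal.ofReal (M / 2 ^ m) ≠ 0 := fun m => by
    have : 0 < M / 2 ^ m := by positivity
    simpa using this
  have hint : ∀ (z : X) (m : ℕ), ∫⁻ y in ball z (M / 2 ^ m), d y ^ (-s) ∂μ ≤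
      K * (3⁻¹ ^ m * ENNReal.ofReal (M / 2 ^ m) ^ (-s)) := fun z m =>
    setLIntegral_rpow_neg_le_of_layers hd hM hs z m (hup z m) (hlayer z m)
  have hscale : ∀ (a t : ℝ≥0∞), a ≠ 0 → a ≠ ∞ → t ≠ ∞ → t ^ (-s) = a ^ s * (a * t) ^ (-s) := by
    intro a t ha hat ht
    rw [ENNReal.mul_rpow_of_ne_top hat ht, ← mul_assoc, ENNReal.rpow_neg a,
      ENNReal.mul_inv_cancel (by simp [ha, hat]) (ENNReal.rpow_ne_top_of_nonneg hs hat), one_mul]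
  have h3pow : ∀ m : ℕ, (3⁻¹ : ℝ≥0∞) ^ m ≠ ∞ := fun m => by simp
  refine ⟨fun z r hr => ?_, fun z r hr => ?_, (hd.pow_const _).aemeasurable, fun z r hr => ?_, ?_⟩
  · obtain ⟨m, h, -⟩ := exists_ball_subset_ball_subset hM hX z hr
    refine lt_of_lt_of_le (pos_iff_ne_zero.mpr ?_) ((hlow z (m + 1)).trans (measure_mono h))
    exact mul_ne_zero hc (by simp)
  · obtain ⟨m, -, h⟩ := exists_ball_subset_ball_subset hM hX z hr
    exact ((measure_mono h).trans (hup z m)).trans_lt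
      (ENNReal.mul_ne_top hC (h3pow m)).lt_top
  · obtain ⟨m, -, h⟩ := exists_ball_subset_ball_subset hM hX z hr
    refine ((lintegral_mono_set h).trans (hint z m)).trans_lt
      (ENNReal.mul_ne_top hK (ENNReal.mul_ne_top (h3pow m) ?_)).lt_top
    rw [ENNReal.rpow_neg]
    exact ENNReal.inv_ne_top.mpr (by simp [hR0])
  · set L := 4 ^ s + K * 3 * c⁻¹ * 3 ^ s with hL
    have hLt : L ≠ ∞ := ENNReal.add_ne_top.mpr ⟨h4s, ENNReal.mul_ne_top (ENNReal.mul_ne_top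
      (ENNReal.mul_ne_top hK (by norm_num)) (ENNReal.inv_ne_top.mpr hc)) h3s⟩
    refine ⟨L.toNNReal, fun z r hr => Filter.Eventually.of_forall fun x hx => ?_⟩
    rw [ENNReal.coe_toNNReal hLt]
    refine ENNReal.div_le_of_le_mul ?_
    obtain ⟨m, hsub, hsup⟩ := exists_ball_subset_ball_subset hM hX z hr
    set R := ENNReal.ofReal (M / 2 ^ m) with hRdef
    have hdist : ∀ y ∈ ball z r, edist y z ≤ R := fun y hy => by
      rw [edist_dist]
      exact ENNReal.ofReal_le_ofReal (mem_ball.mp (hsup hy)).le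
    have hxz : d x ≤ d z + R := (hd_lip x z).trans (by gcongr; exact hdist x hx)
    rcases le_or_gt (2 * R) (d z) with hfar | hnear
    · -- the ball is far from `{d = 0}`, and `d` varies on it by a factor at most `4`
      have hlow' : ∀ y ∈ ball z r, d z / 2 ≤ d y := by
        intro y hy
        have h1 : d z ≤ d y + d z / 2 := by
          refine (hd_lip z y).trans ?_
          gcongr
          rw [edist_comm]
          refine (hdist y hy).trans ?_
          rwa [ENNReal.le_div_iff_mul_le (by simp) (by simp), mul_comm]
        refine ENNReal.le_of_add_le_add_right (a := d z / 2)
          (ENNReal.div_ne_top (hd_top z) (by norm_num)) ?_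
        rwa [ENNReal.add_halves]
      have hx4 : d x ≤ 4 * (d z / 2) := by
        refine hxz.trans ?_
        calc d z + R ≤ d z + 2 * R := by gcongr; exact le_mul_of_one_le_left zero_le (by norm_num)
          _ ≤ d z + d z := by gcongr
          _ = 2 * (2 * (d z / 2)) := by
            rw [ENNReal.mul_div_cancel (by norm_num) (by norm_num), two_mul]
          _ = _ := by rw [← mul_assoc]; norm_num
      calc ∫⁻ y in ball z r, d y ^ (-s) ∂μ ≤ ∫⁻ y in ball z r, (d z / 2) ^ (-s) ∂μ :=
            setLIntegral_mono' measurableSet_ball fun y hy =>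
              ENNReal.rpow_neg_anti hs (hlow' y hy)
        _ = (d z / 2) ^ (-s) * μ (ball z r) := by
            rw [lintegral_const, Measure.restrict_apply_univ]
        _ = 4 ^ s * (4 * (d z / 2)) ^ (-s) * μ (ball z r) := by
            rw [← hscale 4 _ (by norm_num) (by norm_num)
              (ENNReal.div_ne_top (hd_top z) (by norm_num))]
        _ ≤ L * d x ^ (-s) * μ (ball z r) := by
            have := ENNReal.rpow_neg_anti hs hx4
            gcongr ?_ * ?_ * _
            exact le_self_add
    · have hx3 : d x ≤ 3 * R := by
        refine hxz.trans ?_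
        calc d z + R ≤ 2 * R + R := by gcongr
          _ = 3 * R := by ring
      have hc' : c ≠ ∞ := by
        rintro rfl
        have h := (hlow z 0).trans (hup z 0)
        simp only [pow_zero, mul_one] at h
        exact hC (top_le_iff.mp h)
      calc ∫⁻ y in ball z r, d y ^ (-s) ∂μ ≤ K * (3⁻¹ ^ m * R ^ (-s)) :=
            (lintegral_mono_set hsup).trans (hint z m)
        _ = K * (3⁻¹ ^ m * (3 ^ s * (3 * R) ^ (-s))) := by
            rw [← hscale 3 R (by norm_num) (by norm_num) ENNReal.ofReal_ne_top]
        _ ≤ K * (3⁻¹ ^ m * (3 ^ s * d x ^ (-s))) := by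
            have := ENNReal.rpow_neg_anti hs hx3
            gcongr K * (_ * (_ * ?_))
        _ = K * 3 * c⁻¹ * 3 ^ s * d x ^ (-s) * (c * 3⁻¹ ^ (m + 1)) := by
            rw [pow_succ]
            calc _ = K * (3⁻¹ ^ m * (3 ^ s * d x ^ (-s))) * ((3 * 3⁻¹) * (c⁻¹ * c)) := by
                  rw [ENNReal.mul_inv_cancel (by norm_num) (by norm_num),
                    ENNReal.inv_mul_cancel hc hc', one_mul, mul_one]
              _ = _ := by ring
        _ ≤ L * d x ^ (-s) * μ (ball z r) := by
            gcongr
            · exact le_add_self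
            · exact (hlow z (m + 1)).trans (measure_mono hsub)

end Layers

/-! ### Ahlfors regularity -/

lemma isAhlfors_of_ennreal {X : Type*} [MetricSpace X] [MeasurableSpace X] {Y : Set X} {s : ℝ}
    {μ : Measure X} (hμ : μ Yᶜ = 0) {k₁ k₂ : ℝ≥0∞} (h₁ : k₁ ≠ 0) (h₂ : k₂ ≠ ∞)
    (h : ∀ x ∈ Y, ∀ r : ℝ, 0 < r → ENNReal.ofReal r < ediam Y →
      k₁ * ENNReal.ofReal r ^ s ≤ μ (ball x r) ∧ μ (ball x r) ≤ k₂ * ENNReal.ofReal r ^ s) :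
    IsAhlfors Y s μ := by
  set c : ℝ := max 1 (max k₂.toReal k₁⁻¹.toReal) with hc
  have hc1 : 1 ≤ c := le_max_left _ _
  have hk₂ : k₂ ≤ ENNReal.ofReal c := by
    rw [← ENNReal.ofReal_toReal h₂]
    exact ENNReal.ofReal_le_ofReal ((le_max_left _ _).trans (le_max_right _ _))
  have hk₁ : ENNReal.ofReal c⁻¹ ≤ k₁ := by
    rw [ENNReal.ofReal_inv_of_pos (by linarith), ENNReal.inv_le_iff_inv_le,
      ← ENNReal.ofReal_toReal (ENNReal.inv_ne_top.mpr h₁)]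
    exact ENNReal.ofReal_le_ofReal ((le_max_right _ _).trans (le_max_right _ _))
  refine ⟨hμ, c, hc1, fun x hx r hr hrY => ?_⟩
  rw [ENNReal.ofReal_mul (by positivity), ENNReal.ofReal_mul (by positivity),
    ← ENNReal.ofReal_rpow_of_pos hr]
  obtain ⟨h3, h4⟩ := h x hx r hr hrY
  exact ⟨(mul_le_mul_left hk₁ _).trans h3, h4.trans (mul_le_mul_left hk₂ _)⟩

section Gasket

variable {T : Affine.Triangle ℝ Plane} {α : ℝ}

lemma dist_lt_baseRadius {x y : Plane} (hx : x ∈ sierpinskiGasket T)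
    (hy : y ∈ sierpinskiGasket T) : dist x y < baseRadius T := by
  -- all cells of level `0` are equal
  obtain ⟨ω, hω⟩ := exists_mem_cell hx 0
  obtain ⟨ω', hω'⟩ := exists_mem_cell hy 0
  rw [cell_congr (ω' := ω) (by simp)] at hω'
  simpa [scale] using dist_lt_scale_of_mem_cell hω hω'

lemma hausdorffMeasure_gasket_apply (hα0 : 0 < α) (E : Set (sierpinskiGasket T)) :
    Measure.hausdorffMeasure α E = Measure.hausdorffMeasure α ((↑) '' E : Set Plane) :=
  (isometry_subtype_coe.hausdorffMeasure_image (Or.inl hα0.le) E).symm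

lemma hausdorffMeasure_gasket_ball_le (hα : (2 : ℝ≥0∞) ^ α = 3) (hα0 : 0 < α)
    (z : sierpinskiGasket T) (n : ℕ) :
    Measure.hausdorffMeasure α (ball z (scale T n)) ≤
      ENNReal.ofReal (baseRadius T) ^ α * ENNReal.ofReal (cellCount T) * 3⁻¹ ^ n := by
  rw [hausdorffMeasure_gasket_apply hα0, mul_assoc]
  refine (hausdorffMeasure_le_addressMeasure hα hα0 (Subtype.coe_image_subset _ _) n).trans ?_
  refine mul_le_mul_right (addressMeasure_meets_le (z := z) ?_) _
  rintro _ ⟨y, hy, rfl⟩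
  exact (mem_ball.mp hy).le

lemma exists_le_hausdorffMeasure_gasket_ball (hα : (2 : ℝ≥0∞) ^ α = 3) (hα0 : 0 < α) :
    ∃ c : ℝ≥0∞, c ≠ 0 ∧ ∀ (z : sierpinskiGasket T) (n : ℕ),
      c * 3⁻¹ ^ n ≤ Measure.hausdorffMeasure α (ball z (scale T n)) := by
  obtain ⟨c, hc, -, hle⟩ := exists_map_addressMeasure_le (T := T) hα hα0
  refine ⟨c, hc, fun z n => ?_⟩
  obtain ⟨ω, hω⟩ := exists_mem_cell z.2 n
  rw [hausdorffMeasure_gasket_apply hα0, ← addressMeasure_setOf_eq_on_lt n ω]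
  refine le_trans ?_ (hle _)
  rw [Measure.smul_apply, smul_eq_mul]
  refine mul_le_mul_right (le_trans (measure_mono fun ω' hω' => ?_)
    (Measure.le_map_apply (measurable_addressPoint T).aemeasurable _)) _
  refine ⟨⟨_, addressPoint_mem_gasket T ω'⟩, ?_, rfl⟩
  have h := addressPoint_mem_cell T n ω'
  rw [cell_congr hω'] at h
  exact dist_lt_scale_of_mem_cell h hω

/-- The points near the boundary of the triangle have a small barycentric coordinate. -/
lemma hausdorffMeasure_gasket_layer_le (hα : (2 : ℝ≥0∞) ^ α = 3) (hα0 : 0 < α)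
    (z : sierpinskiGasket T) (m k : ℕ) :
    Measure.hausdorffMeasure α
      ({x : sierpinskiGasket T | infEDist (x : Plane) (triangleBoundary T) <
        ENNReal.ofReal (scale T (m + k))} ∩ ball z (scale T m)) ≤
      ENNReal.ofReal (baseRadius T) ^ α * ENNReal.ofReal (3 * cellCount T) *
        (2 ^ k * 3⁻¹ ^ (m + k)) := by
  rw [hausdorffMeasure_gasket_apply hα0, mul_assoc]
  refine (hausdorffMeasure_le_addressMeasure hα hα0 (Subtype.coe_image_subset _ _) (m + k)).trans ?_
  refine mul_le_mul_right (addressMeasure_meets_layer_le (z := z) ?_ ?_) _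
  · rintro _ ⟨y, hy, rfl⟩
    exact (mem_ball.mp hy.2).le
  · rintro _ ⟨y, hy, rfl⟩
    obtain ⟨f, hf, hyf⟩ := infEDist_lt_iff.mp hy.1
    rw [triangleBoundary_eq] at hf
    obtain ⟨-, j, hj⟩ := hf
    refine ⟨j, ?_⟩
    have h := abs_coord_sub_le T j y f
    rw [hj, sub_zero] at h
    rw [edist_dist, ENNReal.ofReal_lt_ofReal_iff (scale_pos T _)] at hyf
    exact (le_abs_self _).trans (h.trans (mul_le_mul_of_nonneg_left hyf.le (coordLip_nonneg T)))

lemma isAhlfors_gasket (hα : (2 : ℝ≥0∞) ^ α = 3) (hα0 : 0 < α) :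
    IsAhlfors (univ : Set (sierpinskiGasket T)) α (Measure.hausdorffMeasure α) := by
  obtain ⟨c, hc, hlow⟩ := exists_le_hausdorffMeasure_gasket_ball (T := T) hα hα0
  have hM := baseRadius_pos T
  set a := ENNReal.ofReal (baseRadius T) ^ α with ha
  have ha0 : a ≠ 0 := (ENNReal.rpow_pos (by simpa using hM) ENNReal.ofReal_ne_top).ne'
  have hat : a ≠ ∞ := ENNReal.rpow_ne_top_of_nonneg hα0.le ENNReal.ofReal_ne_top
  set N := ENNReal.ofReal (cellCount T)
  refine isAhlfors_of_ennreal (by simp) (k₁ := c * (3⁻¹ * a⁻¹)) (k₂ := 3 * N)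
    (mul_ne_zero hc (mul_ne_zero (by simp) (ENNReal.inv_ne_zero.mpr hat)))
    (ENNReal.mul_ne_top (by norm_num) ENNReal.ofReal_ne_top) fun x _ r hr hrS => ?_
  have hdiam : ediam (univ : Set (sierpinskiGasket T)) ≤ ENNReal.ofReal (baseRadius T) :=
    ediam_le fun x _ y _ => by
      rw [edist_dist]
      exact ENNReal.ofReal_le_ofReal (dist_lt_baseRadius x.2 y.2).le
  obtain ⟨n, h1, h2⟩ := exists_div_two_pow_lt_le hr
    ((ENNReal.ofReal_lt_ofReal_iff hM).mp (hrS.trans_le hdiam)).le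
  have h3 : a * 3⁻¹ ^ (n + 1) ≤ ENNReal.ofReal r ^ α := by
    rw [← ofReal_scale_rpow hα hα0.le]
    exact ENNReal.rpow_le_rpow (ENNReal.ofReal_le_ofReal h1.le) hα0.le
  have h4 : ENNReal.ofReal r ^ α ≤ a * 3⁻¹ ^ n := by
    rw [← ofReal_scale_rpow hα hα0.le]
    exact ENNReal.rpow_le_rpow (ENNReal.ofReal_le_ofReal h2) hα0.le
  constructor
  · calc _ ≤ c * (3⁻¹ * a⁻¹) * (a * 3⁻¹ ^ n) := by gcongr
      _ = c * 3⁻¹ ^ (n + 1) * (a⁻¹ * a) := by ring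
      _ = c * 3⁻¹ ^ (n + 1) := by rw [ENNReal.inv_mul_cancel ha0 hat, mul_one]
      _ ≤ _ := (hlow x (n + 1)).trans (measure_mono (ball_subset_ball h1.le))
  · calc _ ≤ a * N * 3⁻¹ ^ n := (measure_mono (ball_subset_ball h2)).trans
          (hausdorffMeasure_gasket_ball_le hα hα0 x n)
      _ = a * N * 3⁻¹ ^ n * (3 * 3⁻¹) := by
          rw [ENNReal.mul_inv_cancel (by norm_num) (by norm_num), mul_one]
      _ = 3 * N * (a * 3⁻¹ ^ (n + 1)) := by ring
      _ ≤ _ := by gcongr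

/-! ### The boundary of the triangle -/

/-- A boundary point lies in the half-size copy of the boundary at some vertex, namely at a vertex
with barycentric coordinate at least `1 / 2`. -/
lemma triangleBoundary_subset_gasket : triangleBoundary T ⊆ sierpinskiGasket T := by
  rw [triangleBoundary_eq]
  refine fun x hx => mem_iInter.mpr fun n => ?_
  induction n generalizing x with
  | zero =>
    rw [gasketStep, fullTriangle_eq]
    exact hx.1
  | succ n ih =>
    obtain ⟨hx0, j, hj⟩ := hx
    have hsum := (triangleBasis T).sum_coord_apply_eq_one x
    obtain ⟨i, hij, hi⟩ : ∃ i, i ≠ j ∧ 1 / 2 ≤ (triangleBasis T).coord i x := by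
      by_contra! h
      rw [Fin.sum_univ_three] at hsum
      fin_cases j
      · linarith [h 1 (by decide), h 2 (by decide), show (triangleBasis T).coord 0 x = 0 from hj]
      · linarith [h 0 (by decide), h 2 (by decide), show (triangleBasis T).coord 1 x = 0 from hj]
      · linarith [h 0 (by decide), h 1 (by decide), show (triangleBasis T).coord 2 x = 0 from hj]
    have hy : ∀ k, (triangleBasis T).coord k (AffineMap.lineMap (T.points i) x (2 : ℝ)) =
        2 * (triangleBasis T).coord k x - if i = k then 1 else 0 := by
      intro k
      rw [AffineMap.apply_lineMap, ← triangleBasis_apply, AffineBasis.coord_apply,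
        AffineMap.lineMap_apply_ring']
      simp only [eq_comm (a := k)]
      ring
    refine mem_iUnion.mpr ⟨i, _, ih (AffineMap.lineMap (T.points i) x (2 : ℝ))
      ⟨fun k => ?_, j, ?_⟩, ext_coord T fun k => ?_⟩
    · rw [hy]
      split_ifs with h
      · subst h; linarith
      · linarith [hx0 k]
    · rw [hy, hj, if_neg hij]; ring
    · rw [coord_midpoint, hy]; ring

lemma triangleBoundary_eq_iUnion : triangleBoundary T = ⋃ j : Fin 3,
    AffineMap.lineMap (T.points (j + 1)) (T.points (j + 2)) '' Icc (0 : ℝ) 1 := by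
  rw [triangleBoundary_eq]
  have hcoord : ∀ (j k : Fin 3) (t : ℝ), (triangleBasis T).coord k
      (AffineMap.lineMap (T.points (j + 1)) (T.points (j + 2)) t) =
        (1 - t) * (if k = j + 1 then 1 else 0) + t * (if k = j + 2 then 1 else 0) := by
    intro j k t
    rw [AffineMap.apply_lineMap, ← triangleBasis_apply, ← triangleBasis_apply,
      AffineBasis.coord_apply, AffineBasis.coord_apply, AffineMap.lineMap_apply_ring]
  ext x
  simp only [mem_ofPred_eq, mem_iUnion, mem_image]
  constructor
  · rintro ⟨hx, j, hj⟩
    have hsum := (triangleBasis T).sum_coord_apply_eq_one x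
    rw [Fin.sum_univ_three] at hsum
    refine ⟨j, (triangleBasis T).coord (j + 2) x, ⟨hx _, ?_⟩, ext_coord T fun k => ?_⟩
    · linarith [hx 0, hx 1, hx 2, (triangleBasis T).sum_coord_apply_eq_one x,
        Finset.single_le_sum (fun k _ => hx k) (Finset.mem_univ (j + 2))]
    · rw [hcoord]
      fin_cases j <;> fin_cases k <;> simp at hj hsum ⊢ <;> linarith
  · rintro ⟨j, t, ht, rfl⟩
    refine ⟨fun k => ?_, j, ?_⟩
    · rw [hcoord]
      split_ifs <;> linarith [ht.1, ht.2]
    · rw [hcoord]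
      fin_cases j <;> simp

lemma isAhlfors_triangleBoundary (hT : T.Equilateral) :
    IsAhlfors (triangleBoundary T) 1
      ((Measure.hausdorffMeasure 1).restrict (triangleBoundary T)) := by
  obtain ⟨L, hL⟩ := hT
  have hM := baseRadius_pos T
  have hmeas : MeasurableSet (triangleBoundary T) := isClosed_frontier.measurableSet
  have hdist : ∀ j : Fin 3, dist (T.points (j + 1)) (T.points (j + 2)) = L :=
    fun j => hL _ _ (by fin_cases j <;> decide)
  have hL0 : 0 < L := by
    rw [← hdist 0]
    exact dist_pos.mpr (T.independent.injective.ne (by decide))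
  have hdiam : ∀ x ∈ triangleBoundary T, ∀ y ∈ triangleBoundary T, dist x y < baseRadius T :=
    fun x hx y hy => dist_lt_baseRadius (triangleBoundary_subset_gasket hx)
      (triangleBoundary_subset_gasket hy)
  have hside : ∀ j : Fin 3, AffineMap.lineMap (T.points (j + 1)) (T.points (j + 2)) ''
      Icc (0 : ℝ) 1 ⊆ triangleBoundary T := by
    rw [triangleBoundary_eq_iUnion]
    exact fun j => subset_iUnion (fun j : Fin 3 => AffineMap.lineMap (T.points (j + 1))
      (T.points (j + 2)) '' Icc (0 : ℝ) 1) j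
  have hLM : L < baseRadius T := by
    rw [← hdist 0]
    refine hdiam _ (hside 0 ⟨0, by simp, by simp⟩) _ (hside 0 ⟨1, by simp, by simp⟩)
  have hlen : ∀ (j : Fin 3) (s : Set ℝ), Measure.hausdorffMeasure 1
      (AffineMap.lineMap (T.points (j + 1)) (T.points (j + 2)) '' s) =
        ENNReal.ofReal L * volume s := by
    intro j s
    rw [hausdorffMeasure_lineMap_image, hausdorffMeasure_real, ENNReal.smul_def, smul_eq_mul,
      ← edist_nndist, edist_dist, hdist]
  refine isAhlfors_of_ennreal (by rw [Measure.restrict_apply hmeas.compl]; simp)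
    (k₁ := ENNReal.ofReal (L / (2 * baseRadius T))) (k₂ := 6) ?_ (by norm_num)
    fun x hx r hr hrF => ?_
  · have : 0 < L / (2 * baseRadius T) := by positivity
    simpa using this
  have hrM : r ≤ baseRadius T := by
    refine ((ENNReal.ofReal_lt_ofReal_iff hM).mp (hrF.trans_le (ediam_le fun x hx y hy => ?_))).le
    rw [edist_dist]
    exact ENNReal.ofReal_le_ofReal (hdiam x hx y hy).le
  rw [Measure.restrict_apply measurableSet_ball, ENNReal.rpow_one]
  constructor
  · -- the ball contains a subsegment of length `L * δ` with one end at its centre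
    have hx' := hx
    rw [triangleBoundary_eq_iUnion] at hx'
    obtain ⟨j, t, ht, rfl⟩ := mem_iUnion.mp hx'
    set δ := r / (2 * baseRadius T) with hδdef
    have hδ0 : 0 < δ := by positivity
    have hδ : δ ≤ 1 / 2 := by
      rw [hδdef, div_le_div_iff₀ (by positivity) (by norm_num)]; linarith
    have hδr : δ * L < r := by
      rw [hδdef, div_mul_eq_mul_div, div_lt_iff₀ (by positivity)]
      nlinarith
    obtain ⟨u, hu0, hu1, hut⟩ : ∃ u : ℝ, 0 ≤ u ∧ u + δ ≤ 1 ∧ ∀ v ∈ Icc u (u + δ), |v - t| ≤ δ := by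
      rcases le_total t (1 / 2) with h | h
      · exact ⟨t, ht.1, by linarith,
          fun v hv => abs_le.mpr ⟨by linarith [hv.1], by linarith [hv.2]⟩⟩
      · exact ⟨t - δ, by linarith, by linarith [ht.2],
          fun v hv => abs_le.mpr ⟨by linarith [hv.1], by linarith [hv.2]⟩⟩
    calc _ = ENNReal.ofReal L * volume (Icc u (u + δ)) := by
          rw [Real.volume_Icc, ← ENNReal.ofReal_mul (by positivity), ← ENNReal.ofReal_mul hL0.le]
          congr 1
          rw [hδdef]; ring
      _ = _ := (hlen j _).symm
      _ ≤ _ := by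
          refine measure_mono ?_
          rintro _ ⟨v, hv, rfl⟩
          refine ⟨?_, hside j ⟨v, ⟨hu0.trans hv.1, hv.2.trans hu1⟩, rfl⟩⟩
          rw [mem_ball, dist_lineMap_lineMap, hdist, Real.dist_eq]
          exact (mul_le_mul_of_nonneg_right (hut v hv) hL0.le).trans_lt hδr
  · have hj : ∀ j : Fin 3, Measure.hausdorffMeasure 1 (AffineMap.lineMap (T.points (j + 1))
        (T.points (j + 2)) '' {t : ℝ | AffineMap.lineMap (T.points (j + 1))
        (T.points (j + 2)) t ∈ ball x r}) ≤ ENNReal.ofReal (2 * r) := by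
      intro j
      rw [hlen]
      have h1 : ediam {t : ℝ | AffineMap.lineMap (T.points (j + 1)) (T.points (j + 2)) t ∈ ball x r}
          ≤ ENNReal.ofReal (2 * r / L) := by
        refine ediam_le fun t ht t' ht' => ?_
        rw [edist_dist]
        refine ENNReal.ofReal_le_ofReal ?_
        rw [le_div_iff₀ hL0, ← hdist j, ← dist_lineMap_lineMap]
        refine (dist_triangle_right _ _ x).trans ?_
        linarith [mem_ball.mp ht, mem_ball.mp ht']
      calc _ ≤ ENNReal.ofReal L * ENNReal.ofReal (2 * r / L) := by
            gcongr
            exact (Real.volume_le_diam _).trans h1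
        _ = _ := by
            rw [← ENNReal.ofReal_mul hL0.le]
            congr 1
            field_simp
    calc _ ≤ Measure.hausdorffMeasure 1 (⋃ j : Fin 3, AffineMap.lineMap (T.points (j + 1))
            (T.points (j + 2)) '' {t : ℝ | AffineMap.lineMap (T.points (j + 1))
            (T.points (j + 2)) t ∈ ball x r}) := by
          refine measure_mono ?_
          rintro y ⟨hy, hyF⟩
          rw [triangleBoundary_eq_iUnion] at hyF
          obtain ⟨j, t, -, rfl⟩ := mem_iUnion.mp hyF
          exact mem_iUnion.mpr ⟨j, t, hy, rfl⟩
      _ ≤ _ := measure_iUnion_le _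
      _ ≤ ∑' _j : Fin 3, ENNReal.ofReal (2 * r) := ENNReal.tsum_le_tsum hj
      _ = 6 * ENNReal.ofReal r := by
          rw [tsum_fintype, Finset.sum_const, Finset.card_univ, Fintype.card_fin, nsmul_eq_mul,
            ENNReal.ofReal_mul (by norm_num), ← mul_assoc]
          norm_num

end Gasket

/-! ### The gasket, its boundary and the distance weight -/

theorem mainTheorem9 (T : Affine.Triangle ℝ Plane) (hT : T.Equilateral)
    (α : ℝ) (hα : α = Real.log 3 / Real.log 2) :
    IsAhlfors (univ : Set (sierpinskiGasket T)) α (Measure.hausdorffMeasure α) ∧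
    triangleBoundary T ⊆ sierpinskiGasket T ∧
    IsAhlfors (triangleBoundary T) 1
      ((Measure.hausdorffMeasure 1).restrict (triangleBoundary T)) ∧
    ∀ γ : ℝ, 0 ≤ γ → γ < 1 →
      IsMuckenhouptA1 (Measure.hausdorffMeasure α : Measure (sierpinskiGasket T))
        (fun x => infEDist (x : Plane) (triangleBoundary T) ^ ((1 - α) * γ)) := by
  have hlog2 : 0 < Real.log 2 := Real.log_pos (by norm_num)
  have hα1 : 1 < α := by
    rw [hα, lt_div_iff₀ hlog2, one_mul]
    exact Real.log_lt_log (by norm_num) (by norm_num)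
  have hα0 : 0 < α := by linarith
  have h23 : (2 : ℝ≥0∞) ^ α = 3 := by
    have h : (2 : ℝ) ^ α = 3 := by
      rw [Real.rpow_def_of_pos (by norm_num), hα, mul_div_cancel₀ _ hlog2.ne',
        Real.exp_log (by norm_num)]
    rw [← ENNReal.ofReal_ofNat 2, ENNReal.ofReal_rpow_of_pos (by norm_num), h,
      ENNReal.ofReal_ofNat]
  refine ⟨isAhlfors_gasket h23 hα0, triangleBoundary_subset_gasket, isAhlfors_triangleBoundary hT,
    fun γ hγ0 hγ1 => ?_⟩
  obtain ⟨c, hc, hlow⟩ := exists_le_hausdorffMeasure_gasket_ball (T := T) h23 hα0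
  have hs : 0 ≤ (α - 1) * γ := mul_nonneg (by linarith) hγ0
  have hs' : 2 * (2 : ℝ≥0∞) ^ ((α - 1) * γ) < 3 := by
    calc 2 * (2 : ℝ≥0∞) ^ ((α - 1) * γ) = 2 ^ (1 + (α - 1) * γ) := by
          rw [ENNReal.rpow_add _ _ (by norm_num) (by norm_num), ENNReal.rpow_one]
      _ < 2 ^ α := ENNReal.rpow_lt_rpow_of_exponent_lt (by norm_num) (by norm_num) (by nlinarith)
      _ = 3 := h23
  have hne : (triangleBoundary T).Nonempty := by
    rw [triangleBoundary_eq_iUnion]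
    exact ⟨_, mem_iUnion.mpr ⟨0, 0, by simp, rfl⟩⟩
  have hat : ENNReal.ofReal (baseRadius T) ^ α ≠ ∞ :=
    ENNReal.rpow_ne_top_of_nonneg hα0.le ENNReal.ofReal_ne_top
  rw [show (1 - α) * γ = -((α - 1) * γ) by ring]
  exact isMuckenhouptA1_rpow_neg_of_layers
    (measurable_infEDist.comp measurable_subtype_coe) (fun x => infEDist_ne_top hne)
    (fun x y => infEDist_le_infEDist_add_edist) (baseRadius_pos T)
    (fun x y => dist_lt_baseRadius x.2 y.2) hs hs' hc
    (ENNReal.mul_ne_top hat ENNReal.ofReal_ne_top) (ENNReal.mul_ne_top hat ENNReal.ofReal_ne_top)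
    hlow (hausdorffMeasure_gasket_ball_le h23 hα0) (hausdorffMeasure_gasket_layer_le h23 hα0)
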